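/- Let $\Omega\subset\mathbb{R}^d$ be a measurable set of finite Lebesgue measure, let $n\ge 1$, and let $P=\operatorname{conv}\{v_1,\dots,v_q\}\subset\mathbb{R}^n$ be a convex polytope with vertices $v_1,\dots,v_q$ and non-empty interior. Define $R:\mathbb{R}^n\to\mathbb{R}\cup\{+\infty\}$ by $$R(x)=\inf\Big\{\sum_{i=1}^q\lambda_i\ln\lambda_i \;:\; \lambda_i\ge 0,\ \sum_{i=1}^q\lambda_i=1,\ \sum_{i=1}^q\lambda_i v_i=x\Big\},\qquad 0\ln 0=0,\ \inf\emptyset=+\infty,$$ and let $\mathcal{D}_R(p,y)=R(p)-R(y)-\nabla R(y)\cdot(p-y)$. Let $W\in\mathbb{R}^{r\times n}$ and $b\in\mathbb{R}^r$; inequalities $\preccurlyeq,\prec$ between vectors are componentwise. Put $$\mathcal{K}=\{\eta\in L^\infty(\Omega;\mathbb{R}^n):\eta(x)\in P\text{ for a.e. }x\},\qquad \mathring{\mathcal{K}}=\{\eta\in\mathcal{K}:\operatorname*{ess\,inf}_{x\in\Omega}\operatorname{dist}(\eta(x),\partial P)>0\},$$ and $\mathcal{M}=\{\eta\in L^\infty(\Omega;\mathbb{R}^n):\int_\Omega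 W\eta\,dx\preccurlyeq b\}$. Assume that some $\eta\in\mathcal{K}$ satisfies $\int_\Omega W\eta\,dx\prec b$. Let $F:L^\infty(\Omega;\mathbb{R}^n)\to\mathbb{R}$ be continuously Fréchet differentiable on $\mathcal{K}\cap\mathcal{M}$, let $v\in\mathring{\mathcal{K}}$ with $\nabla R(v)\in L^\infty(\Omega;\mathbb{R}^n)$, let $F$ be Fréchet differentiable at $v$ as well, and assume that at each $\eta\in(\mathcal{K}\cap\mathcal{M})\cup\{v\}$ the derivative is represented by some $\nabla F(\eta)\in L^\infty(\Omega;\mathbb{R}^n)$, i.e. $\int_\Omega\nabla F(\eta)\cdot q\,dx=\langle F'(\eta),q\rangle$ for all $q\in L^\infty(\Omega;\mathbb{R}^n)$. Let $\alpha>0$. Then the problem $$\min_{\eta\in L^1(\Omega;\mathbb{R}^n)}\int_\Omega\alpha\nabla F(v)\cdot\eta+\mathcal{D}_R(\eta,v)\,dx\quad\text{subject to}\quad\int_\Omega W\eta\,dx\preccurlyeq b$$ has a unique minimizer $\eta^\star$. Moreover $\eta^\star\in\mathring{\mathcal{K}}$ and $\nabla R(\eta^\star)\in L^\infty(\Omega;\mathbb{R}^n)$.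 The minimizer is characterized as follows: $\eta\in L^1(\Omega;\mathbb{R}^n)$ equals $\eta^\star$ if and only if $\eta(x)\in\operatorname{int}P$ for a.e. $x$, $\int_\Omega W\eta\,dx\preccurlyeq b$, and there is a multiplier $\mu^\star\in\mathbb{R}^r$, $\mu^\star\succcurlyeq 0$, with $\mu^\star_i\big((\int_\Omega W\eta\,dx)_i-b_i\big)=0$ for $i=1,\dots,r$ and $$\nabla R(\eta)=\nabla R(v)-\alpha\nabla F(v)-W^\top\mu^\star\quad\text{a.e. in }\Omega.$$ Finally, $\eta^\star$ is also the unique minimizer of the same problem posed over $L^\infty(\Omega;\mathbb{R}^n)$ instead of $L^1(\Omega;\mathbb{R}^n)$. -/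

import Mathlib

open MeasureTheory
open scoped ENNReal Matrix

noncomputable section

namespace MirrorDescent

/-- `ℝⁿ` with the Euclidean norm. -/
abbrev Euc (n : ℕ) : Type := EuclideanSpace ℝ (Fin n)

/-- The polytope `conv {v₁, …, v_q}`. -/
def polytope {n q : ℕ} (V : Fin q → Euc n) : Set (Euc n) :=
  convexHull ℝ (Set.range V)

/-- The polytopal Legendre function
`R(x) = inf { ∑ λᵢ ln λᵢ | λ ∈ Δ^{q-1}, ∑ λᵢ vᵢ = x } ∈ ℝ ∪ {+∞}`. The infimum over the empty set
is `+∞`, and `0 ln 0 = 0` because `Real.log 0 = 0`. -/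
def polyLegendre {n q : ℕ} (V : Fin q → Euc n) (x : Euc n) : EReal :=
  ⨅ l ∈ {l : Fin q → ℝ | l ∈ stdSimplex ℝ (Fin q) ∧ ∑ i, l i • V i = x},
    ((∑ i, l i * Real.log (l i) : ℝ) : EReal)

/-- `g` is the gradient at `y` of the extended-real-valued function `R`; it is used only at
interior points `y` of the effective domain, near which `R` is real-valued. -/
def HasGrad {n : ℕ} (R : Euc n → EReal) (g y : Euc n) : Prop :=
  HasGradientAt (fun z => (R z).toReal) g y

/-- The gradient `∇R(y)`, for `y` in the interior of the effective domain. -/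
def grad {n : ℕ} (R : Euc n → EReal) (y : Euc n) : Euc n :=
  gradient (fun z => (R z).toReal) y

/-- The Bregman divergence `D_R(p, y) = R(p) - R(y) - ∇R(y) · (p - y)`. -/
def bregman {n : ℕ} (R : Euc n → EReal) (p y : Euc n) : EReal :=
  R p - R y - ((inner ℝ (grad R y) (p - y) : ℝ) : EReal)

/-- The Lebesgue integral `∫ f⁺ - ∫ f⁻` of an extended-real-valued function. -/
def eintegral {X : Type*} [MeasurableSpace X] (μ : Measure X) (f : X → EReal) : EReal :=
  ((∫⁻ x, (f x).toENNReal ∂μ : ℝ≥0∞) : EReal) - ((∫⁻ x, (-f x).toENNReal ∂μ : ℝ≥0∞) : EReal)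

section Fields

variable {X : Type*} [MeasurableSpace X] {n r : ℕ}

/-- The objective `η ↦ ∫ α g · η + D_R(η, v) dμ` of the mirror-descent subproblem, with values in
the extended reals. -/
def objective (μ : Measure X) (R : Euc n → EReal) (α : ℝ) (g v η : X → Euc n) : EReal :=
  eintegral μ fun x => ((α * inner ℝ (g x) (η x) : ℝ) : EReal) + bregman R (η x) (v x)

/-- The `i`-th component of `∫ W η dμ`. -/
def globalValue (μ : Measure X) (W : Matrix (Fin r) (Fin n) ℝ) (η : X → Euc n) (i : Fin r) : ℝ :=
  ∫ x, (W *ᵥ (η x).ofLp) i ∂μ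

/-- The fields in `L^p(μ; ℝⁿ)` with `∫ W η dμ ≼ b`. -/
def globalSet (p : ℝ≥0∞) (μ : Measure X) (W : Matrix (Fin r) (Fin n) ℝ) (b : Fin r → ℝ) :
    Set (Lp (Euc n) p μ) :=
  {η | ∀ i, globalValue μ W η i ≤ b i}

/-- `K`: the fields in `L^∞` with values in `P` almost everywhere. -/
def pointwiseSet (μ : Measure X) (P : Set (Euc n)) : Set (Lp (Euc n) ∞ μ) :=
  {η | ∀ᵐ x ∂μ, η x ∈ P}

/-- `K̊`: the members of `K` whose values stay uniformly away from the boundary of `P`. -/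
def pointwiseInterior (μ : Measure X) (P : Set (Euc n)) : Set (Lp (Euc n) ∞ μ) :=
  {η | η ∈ pointwiseSet μ P ∧ 0 < essInf (fun x => Metric.infEDist (η x) (frontier P)) μ}

/-- `F` is Fréchet differentiable at `η`, and `g ∈ L^∞` represents the derivative:
`∫ g · q dμ = ⟨F'(η), q⟩` for all `q ∈ L^∞`. -/
def HasPrimalGradientAt {μ : Measure X} (F : Lp (Euc n) ∞ μ → ℝ) (g η : Lp (Euc n) ∞ μ) : Prop :=
  DifferentiableAt ℝ F η ∧
    ∀ q : Lp (Euc n) ∞ μ, ∫ x, (inner ℝ (g x) (q x) : ℝ) ∂μ = fderiv ℝ F η q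

/-- `F` is continuously Fréchet differentiable on `S`, with derivatives represented in `L^∞`. -/
def ContDiffWithPrimalGradientOn {μ : Measure X} (F : Lp (Euc n) ∞ μ → ℝ)
    (S : Set (Lp (Euc n) ∞ μ)) : Prop :=
  (∀ η ∈ S, ∃ g : Lp (Euc n) ∞ μ, HasPrimalGradientAt F g η) ∧ ContinuousOn (fderiv ℝ F) S

/-- The optimality system: `η` takes values in the interior of `P`, `∫ W η dμ ≼ b`, and for a
multiplier `m ≽ 0` with `mᵢ ((∫ W η dμ)ᵢ - bᵢ) = 0` for all `i`,
`∇R(η) = ∇R(v) - α g - Wᵀ m` almost everywhere. -/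
def IsKKT (μ : Measure X) (P : Set (Euc n)) (R : Euc n → EReal)
    (W : Matrix (Fin r) (Fin n) ℝ) (b : Fin r → ℝ) (α : ℝ) (g v η : X → Euc n)
    (m : Fin r → ℝ) : Prop :=
  (∀ᵐ x ∂μ, η x ∈ interior P) ∧
    (∀ i, globalValue μ W η i ≤ b i) ∧
    (∀ i, 0 ≤ m i) ∧
    (∀ i, m i * (globalValue μ W η i - b i) = 0) ∧
    ∀ᵐ x ∂μ, HasGrad R (grad R (v x) - α • g x - WithLp.toLp 2 (Wᵀ *ᵥ m)) (η x)

end Fields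

/-- `a` is the unique minimizer of `J` over `C`. -/
def IsUniqueMinimizer {A : Type*} (J : A → EReal) (C : Set A) (a : A) : Prop :=
  a ∈ C ∧ IsMinOn J C a ∧ ∀ a' ∈ C, IsMinOn J C a' → a' = a

end MirrorDescent

end

/-! The proof is convex duality with explicit conjugates. By the Gibbs variational principle,
`polyLegendre` has conjugate `logSumExp`, whose gradient `dualMap` is the softmax mean of the
vertices. The entropy gap is a Kullback–Leibler divergence, so Fenchel–Young holds with equality
exactly at x = `dualMap V y`; this identifies ∇R as the inverse of `dualMap` (`hasGrad_iff`).

With c = ∇R(v) - α g, the optimality system reads η = `dualMap V (c - Wᵀm)`, so only the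
finite-dimensional m is unknown. It is found by minimizing `dualFunction` over m ≥ 0: strict
feasibility makes this function coercive, and its one-sided first-order conditions are feasibility
and complementary slackness (`exists_multiplier`).

Sufficiency is direct: against an optimality-system field, the Lagrangian difference of any
competitor with values in P is the integral of a nonnegative Fenchel–Young gap, which vanishes only
if the fields agree (`IsKKT.ae_eq_of_objective_le`). This gives minimality and uniqueness in every
L^p, p ≥ 1. As c - Wᵀm is bounded, the values of η lie in a compact subset of the interior of P. -/

namespace MirrorDescent

open Filter Topology

/-! ### Entropy and softmax weights on the simplex. -/

noncomputable section Polytope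

variable {n q : ℕ} (V : Fin q → Euc n)

/-- The negative entropy `∑ lᵢ ln lᵢ`. -/
def negEntropy (l : Fin q → ℝ) : ℝ := ∑ i, l i * Real.log (l i)

/-- The log-sum-exp function `y ↦ ln ∑ exp (y · vᵢ)`, the convex conjugate of `polyLegendre`. -/
def logSumExp (y : Euc n) : ℝ := Real.log (∑ i, Real.exp (inner ℝ y (V i)))

/-- The weights `exp (y · vᵢ) / ∑ⱼ exp (y · vⱼ)`. -/
def softmax (y : Euc n) (i : Fin q) : ℝ := Real.exp (inner ℝ y (V i) - logSumExp V y)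

/-- The mean of the vertices under `softmax`, which is the gradient of `logSumExp`. -/
def dualMap (y : Euc n) : Euc n := ∑ i, softmax V y i • V i

variable {V}

lemma mem_polytope_iff {x : Euc n} :
    x ∈ polytope V ↔ ∃ l ∈ stdSimplex ℝ (Fin q), ∑ i, l i • V i = x := by
  have : polytope V = Fintype.linearCombination ℝ V '' stdSimplex ℝ (Fin q) := by
    rw [polytope, ← convexHull_basis_eq_stdSimplex (R := ℝ), LinearMap.image_convexHull, ← Set.range_comp]
    congr 2
    ext1 i
    simp [Fintype.linearCombination_apply]
  rw [this]
  simp [Fintype.linearCombination_apply]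

lemma isCompact_polytope : IsCompact (polytope V) :=
  (Set.finite_range V).isCompact_convexHull (𝕜 := ℝ)

lemma nonempty_fin_of_interior (hP : (interior (polytope V)).Nonempty) : Nonempty (Fin q) := by
  obtain ⟨x, hx⟩ := hP
  have h : (polytope V).Nonempty := ⟨x, interior_subset hx⟩
  exact Set.range_nonempty_iff_nonempty.1 (convexHull_nonempty_iff.1 h)

lemma continuous_negEntropy : Continuous (negEntropy (q := q)) :=
  continuous_finsetSum _ fun i _ => Real.continuous_mul_log.comp (continuous_apply i)

lemma negEntropy_nonpos {l : Fin q → ℝ} (hl : l ∈ stdSimplex ℝ (Fin q)) : negEntropy l ≤ 0 :=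
  Finset.sum_nonpos fun i _ => mul_nonpos_of_nonneg_of_nonpos (hl.1 i)
    (Real.log_nonpos (hl.1 i) (mem_Icc_of_mem_stdSimplex hl i).2)

lemma sum_exp_pos [Nonempty (Fin q)] (y : Euc n) : 0 < ∑ i, Real.exp (inner ℝ y (V i)) :=
  Finset.sum_pos (fun _ _ => Real.exp_pos _) Finset.univ_nonempty

lemma softmax_pos (y : Euc n) (i : Fin q) : 0 < softmax V y i := Real.exp_pos _

lemma log_softmax (y : Euc n) (i : Fin q) :
    Real.log (softmax V y i) = inner ℝ y (V i) - logSumExp V y := Real.log_exp _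

lemma softmax_mem [Nonempty (Fin q)] (y : Euc n) : softmax V y ∈ stdSimplex ℝ (Fin q) := by
  refine ⟨fun i => (softmax_pos y i).le, ?_⟩
  simp only [softmax, Real.exp_sub, ← Finset.sum_div, logSumExp]
  rw [Real.exp_log (sum_exp_pos y), div_self (sum_exp_pos y).ne']

lemma dualMap_mem [Nonempty (Fin q)] (y : Euc n) : dualMap V y ∈ polytope V :=
  mem_polytope_iff.2 ⟨_, softmax_mem y, rfl⟩

lemma inner_sum_smul (y : Euc n) (l : Fin q → ℝ) :
    inner ℝ y (∑ i, l i • V i) = ∑ i, l i * inner ℝ y (V i) := by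
  simp [inner_sum, inner_smul_right]

/-- The right side is the divergence of l from the softmax weights. Since `klFun` is nonnegative and
vanishes only at 1, both the Gibbs inequality and its equality case follow. -/
lemma negEntropy_sub_eq_sum_klFun [Nonempty (Fin q)] (y : Euc n) {l : Fin q → ℝ}
    (hl : l ∈ stdSimplex ℝ (Fin q)) :
    negEntropy l - (inner ℝ y (∑ i, l i • V i) - logSumExp V y) =
      ∑ i, softmax V y i * InformationTheory.klFun (l i / softmax V y i) := by
  have h1 : ∀ i, softmax V y i * InformationTheory.klFun (l i / softmax V y i) =
      l i * Real.log (l i) - l i * inner ℝ y (V i) + l i * logSumExp V y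
        + softmax V y i - l i := by
    intro i
    have hs := softmax_pos (V := V) y i
    rcases eq_or_ne (l i) 0 with h0 | h0
    · simp [h0, InformationTheory.klFun]
    · rw [InformationTheory.klFun, Real.log_div h0 hs.ne', log_softmax]
      field_simp
      ring
  simp_rw [h1, Finset.sum_sub_distrib, Finset.sum_add_distrib, Finset.sum_sub_distrib,
    ← Finset.sum_mul, hl.2, (softmax_mem (V := V) y).2, inner_sum_smul, negEntropy]
  ring

lemma le_negEntropy [Nonempty (Fin q)] (y : Euc n) {l : Fin q → ℝ}
    (hl : l ∈ stdSimplex ℝ (Fin q)) :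
    inner ℝ y (∑ i, l i • V i) - logSumExp V y ≤ negEntropy l := by
  rw [← sub_nonneg, negEntropy_sub_eq_sum_klFun y hl]
  exact Finset.sum_nonneg fun i _ => mul_nonneg (softmax_pos y i).le
    (InformationTheory.klFun_nonneg (div_nonneg (hl.1 i) (softmax_pos y i).le))

lemma eq_softmax_of_negEntropy_le [Nonempty (Fin q)] (y : Euc n) {l : Fin q → ℝ}
    (hl : l ∈ stdSimplex ℝ (Fin q))
    (h : negEntropy l ≤ inner ℝ y (∑ i, l i • V i) - logSumExp V y) : l = softmax V y := by
  have hn : ∀ i, 0 ≤ l i / softmax V y i := fun i => div_nonneg (hl.1 i) (softmax_pos y i).le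
  have h0 : ∑ i, softmax V y i * InformationTheory.klFun (l i / softmax V y i) = 0 := by
    rw [← negEntropy_sub_eq_sum_klFun y hl]
    linarith [le_negEntropy (V := V) y hl]
  rw [Finset.sum_eq_zero_iff_of_nonneg fun i _ => mul_nonneg (softmax_pos y i).le
    (InformationTheory.klFun_nonneg (hn i))] at h0
  ext i
  have h1 := (mul_eq_zero.1 (h0 i (Finset.mem_univ i))).resolve_left (softmax_pos y i).ne'
  exact (div_eq_one_iff_eq (softmax_pos y i).ne').1
    ((InformationTheory.klFun_eq_zero_iff (hn i)).1 h1)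

lemma negEntropy_softmax [Nonempty (Fin q)] (y : Euc n) :
    negEntropy (softmax V y) = inner ℝ y (dualMap V y) - logSumExp V y := by
  have h : ∀ i, softmax V y i * Real.log (softmax V y i) =
      softmax V y i * inner ℝ y (V i) - softmax V y i * logSumExp V y := by
    intro i
    rw [log_softmax]
    ring
  rw [negEntropy, Finset.sum_congr rfl fun i _ => h i, Finset.sum_sub_distrib, ← Finset.sum_mul,
    (softmax_mem y).2, dualMap, inner_sum_smul, one_mul]

/-! ### The polytopal Legendre function -/

lemma polyLegendre_le {l : Fin q → ℝ} (hl : l ∈ stdSimplex ℝ (Fin q)) :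
    polyLegendre V (∑ i, l i • V i) ≤ (negEntropy l : ℝ) :=
  iInf₂_le (f := fun l (_ : l ∈ {l : Fin q → ℝ | l ∈ stdSimplex ℝ (Fin q) ∧ _}) =>
    ((∑ i, l i * Real.log (l i) : ℝ) : EReal)) l ⟨hl, rfl⟩

lemma polyLegendre_eq_top {x : Euc n} (hx : x ∉ polytope V) : polyLegendre V x = ⊤ := by
  refine iInf₂_eq_top.2 fun l hl => (hx (mem_polytope_iff.2 ⟨l, hl.1, hl.2⟩)).elim

/-- The admissible weights form a compact set and the entropy is continuous, so the infimum is
attained and R is real on the polytope. -/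
lemma exists_polyLegendre_eq {x : Euc n} (hx : x ∈ polytope V) :
    ∃ l ∈ stdSimplex ℝ (Fin q), ∑ i, l i • V i = x ∧ polyLegendre V x = (negEntropy l : ℝ) := by
  have hc : IsCompact {l : Fin q → ℝ | l ∈ stdSimplex ℝ (Fin q) ∧ ∑ i, l i • V i = x} := by
    have hcl : IsClosed {l : Fin q → ℝ | ∑ i, l i • V i = x} :=
      isClosed_eq (by fun_prop) continuous_const
    exact (isCompact_stdSimplex ℝ (Fin q)).inter_right hcl
  obtain ⟨l₀, hl₀, hx₀⟩ := mem_polytope_iff.1 hx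
  obtain ⟨l, hl, hmin⟩ := hc.exists_isMinOn ⟨l₀, hl₀, hx₀⟩ continuous_negEntropy.continuousOn
  refine ⟨l, hl.1, hl.2, le_antisymm ((polyLegendre_le hl.1).trans_eq' (by rw [hl.2])) ?_⟩
  exact le_iInf₂ fun l' hl' => EReal.coe_le_coe_iff.2 (hmin hl')

variable (V) in
/-- The real values of `polyLegendre` on the polytope. -/
def realLegendre (x : Euc n) : ℝ := (polyLegendre V x).toReal

lemma polyLegendre_eq_coe {x : Euc n} (hx : x ∈ polytope V) :
    polyLegendre V x = (realLegendre V x : ℝ) := by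
  obtain ⟨l, -, -, h⟩ := exists_polyLegendre_eq hx
  rw [realLegendre, h, EReal.toReal_coe]

lemma exists_realLegendre_eq {x : Euc n} (hx : x ∈ polytope V) :
    ∃ l ∈ stdSimplex ℝ (Fin q), ∑ i, l i • V i = x ∧ realLegendre V x = negEntropy l := by
  obtain ⟨l, hl, hx, h⟩ := exists_polyLegendre_eq hx
  exact ⟨l, hl, hx, by rw [realLegendre, h, EReal.toReal_coe]⟩

lemma realLegendre_le {l : Fin q → ℝ} (hl : l ∈ stdSimplex ℝ (Fin q)) :
    realLegendre V (∑ i, l i • V i) ≤ negEntropy l := by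
  have h := polyLegendre_le (V := V) hl
  rwa [polyLegendre_eq_coe (mem_polytope_iff.2 ⟨l, hl, rfl⟩), EReal.coe_le_coe_iff] at h

lemma realLegendre_nonpos {x : Euc n} (hx : x ∈ polytope V) : realLegendre V x ≤ 0 := by
  obtain ⟨l, hl, -, h⟩ := exists_realLegendre_eq hx
  exact h ▸ negEntropy_nonpos hl

/-- The Fenchel–Young inequality. -/
lemma inner_sub_le_realLegendre [Nonempty (Fin q)] (y : Euc n) {x : Euc n}
    (hx : x ∈ polytope V) : inner ℝ y x - logSumExp V y ≤ realLegendre V x := by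
  obtain ⟨l, hl, rfl, h⟩ := exists_realLegendre_eq hx
  exact h ▸ le_negEntropy y hl

lemma realLegendre_dualMap [Nonempty (Fin q)] (y : Euc n) :
    realLegendre V (dualMap V y) = inner ℝ y (dualMap V y) - logSumExp V y :=
  le_antisymm ((realLegendre_le (softmax_mem y)).trans_eq (negEntropy_softmax y))
    (inner_sub_le_realLegendre y (dualMap_mem y))

/-- The equality case of the Fenchel–Young inequality. -/
lemma eq_dualMap_of_realLegendre_le [Nonempty (Fin q)] {x y : Euc n} (hx : x ∈ polytope V)
    (h : realLegendre V x ≤ inner ℝ y x - logSumExp V y) : x = dualMap V y := by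
  obtain ⟨l, hl, rfl, h'⟩ := exists_realLegendre_eq hx
  rw [h'] at h
  rw [dualMap, ← eq_softmax_of_negEntropy_le y hl h]

lemma neg_log_card_le_realLegendre [Nonempty (Fin q)] {x : Euc n} (hx : x ∈ polytope V) :
    -Real.log q ≤ realLegendre V x := by
  simpa [logSumExp] using inner_sub_le_realLegendre 0 hx

lemma convexOn_realLegendre : ConvexOn ℝ (polytope V) (realLegendre V) := by
  refine ⟨convex_convexHull ℝ _, fun x hx z hz a b ha hb hab => ?_⟩
  obtain ⟨l, hl, rfl, h⟩ := exists_realLegendre_eq hx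
  obtain ⟨l', hl', rfl, h'⟩ := exists_realLegendre_eq hz
  have hs : a • ∑ i, l i • V i + b • ∑ i, l' i • V i = ∑ i, (a • l + b • l') i • V i := by
    simp [Finset.smul_sum, add_smul, Finset.sum_add_distrib, mul_smul]
  rw [h, h', hs]
  refine (realLegendre_le (convex_stdSimplex ℝ _ hl hl' ha hb hab)).trans ?_
  simp only [negEntropy, smul_eq_mul, Finset.mul_sum, ← Finset.sum_add_distrib, Pi.add_apply,
    Pi.smul_apply]
  exact Finset.sum_le_sum fun i _ => Real.convexOn_mul_log.2 (hl.1 i) (hl'.1 i) ha hb hab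

/-- Attainment makes each sublevel set below ⊤ the linear image of a compact set of weights, hence
closed. -/
lemma measurable_polyLegendre : Measurable (polyLegendre V) := by
  refine measurable_of_Iic fun a => ?_
  rcases eq_or_ne a ⊤ with rfl | ha
  · simp
  have h : polyLegendre V ⁻¹' Set.Iic a = (fun l : Fin q → ℝ => ∑ i, l i • V i) ''
      (stdSimplex ℝ (Fin q) ∩ {l | (negEntropy l : EReal) ≤ a}) := by
    ext x
    constructor
    · intro hx
      have hxP : x ∈ polytope V := by
        by_contra hxP
        rw [Set.mem_preimage, polyLegendre_eq_top hxP, Set.mem_Iic, top_le_iff] at hx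
        exact ha hx
      obtain ⟨l, hl, hlx, h⟩ := exists_polyLegendre_eq hxP
      exact ⟨l, ⟨hl, by rwa [Set.mem_preimage, h] at hx⟩, hlx⟩
    · rintro ⟨l, ⟨hl, hla⟩, rfl⟩
      exact (polyLegendre_le hl).trans hla
  rw [h]
  refine (IsCompact.image ?_ (by fun_prop)).isClosed.measurableSet
  exact (isCompact_stdSimplex ℝ (Fin q)).inter_right
    (isClosed_le (continuous_coe_real_ereal.comp continuous_negEntropy) continuous_const)

lemma measurable_realLegendre : Measurable (realLegendre V) :=
  measurable_polyLegendre.ereal_toReal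

/-! ### Gradients -/

/-- Around an interior point every direction is a scaled difference of two convex combinations, so
zero-sum weights already reach all of the space. The linear section A then moves weights along with
the point they represent. -/
lemma exists_rightInverse_vertices (hP : (interior (polytope V)).Nonempty) :
    ∃ A : Euc n →L[ℝ] (Fin q → ℝ), ∀ d, ∑ i, A d i • V i = d ∧ ∑ i, A d i = 0 := by
  let S : Submodule ℝ (Fin q → ℝ) := LinearMap.ker (Fintype.linearCombination ℝ fun _ => (1 : ℝ))
  have hS : ∀ l : Fin q → ℝ, l ∈ S ↔ ∑ i, l i = 0 := by
    intro l
    simp [S, Fintype.linearCombination_apply]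
  have hsurj : Function.Surjective ((Fintype.linearCombination ℝ V).comp S.subtype) := by
    intro d
    obtain ⟨x, hx⟩ := hP
    have hev : ∀ᶠ t : ℝ in 𝓝 0, x + t • d ∈ polytope V := by
      have hc : ContinuousAt (fun t : ℝ => x + t • d) 0 := by fun_prop
      exact hc (by simpa using mem_interior_iff_mem_nhds.1 hx)
    obtain ⟨t, ht, ht0⟩ := ((hev.filter_mono nhdsWithin_le_nhds).and
      (self_mem_nhdsWithin (s := Set.Ioi (0 : ℝ)))).exists
    obtain ⟨l, hl, hlx⟩ := mem_polytope_iff.1 (interior_subset hx)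
    obtain ⟨l', hl', hlx'⟩ := mem_polytope_iff.1 ht
    refine ⟨⟨t⁻¹ • (l' - l), (hS _).2 ?_⟩, ?_⟩
    · simp [← Finset.mul_sum, hl.2, hl'.2]
    · simp only [LinearMap.comp_apply, Submodule.subtype_apply, map_smul, map_sub,
        Fintype.linearCombination_apply, hlx, hlx']
      rw [add_sub_cancel_left, inv_smul_smul₀ (ne_of_gt ht0)]
  obtain ⟨A, hA⟩ := LinearMap.exists_rightInverse_of_surjective _ (LinearMap.range_eq_top.2 hsurj)
  refine ⟨LinearMap.toContinuousLinearMap (S.subtype.comp A), fun d => ⟨?_, (hS _).1 (A d).2⟩⟩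
  simpa [Fintype.linearCombination_apply] using LinearMap.congr_fun hA d

lemma exists_weights_near_dualMap (hP : (interior (polytope V)).Nonempty) (y : Euc n) :
    ∃ A : Euc n →L[ℝ] (Fin q → ℝ), (∀ d, ∑ i, A d i • V i = d ∧ ∑ i, A d i = 0) ∧
      ∀ᶠ z in 𝓝 (dualMap V y), softmax V y + A (z - dualMap V y) ∈ stdSimplex ℝ (Fin q) ∧
        ∑ i, (softmax V y + A (z - dualMap V y)) i • V i = z := by
  have := nonempty_fin_of_interior hP
  obtain ⟨A, hA⟩ := exists_rightInverse_vertices hP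
  refine ⟨A, hA, ?_⟩
  have hev : ∀ᶠ z in 𝓝 (dualMap V y), ∀ i, 0 < (softmax V y + A (z - dualMap V y)) i := by
    rw [eventually_all]
    intro i
    have hc : Continuous fun z => (softmax V y + A (z - dualMap V y)) i := by fun_prop
    exact hc.continuousAt.eventually (lt_mem_nhds (by simpa using softmax_pos y i))
  filter_upwards [hev] with z hz
  refine ⟨⟨fun i => (hz i).le, ?_⟩, ?_⟩
  · simp [Finset.sum_add_distrib, (hA _).2, (softmax_mem y).2]
  · simp only [Pi.add_apply, add_smul, Finset.sum_add_distrib, (hA _).1]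
    simp [dualMap]

lemma dualMap_mem_interior (hP : (interior (polytope V)).Nonempty) (y : Euc n) :
    dualMap V y ∈ interior (polytope V) := by
  obtain ⟨A, -, h⟩ := exists_weights_near_dualMap hP y
  rw [mem_interior_iff_mem_nhds]
  filter_upwards [h] with z hz
  exact mem_polytope_iff.2 ⟨_, hz⟩

/-- R is squeezed between the affine Fenchel–Young minorant and the smooth entropy of the weights
shifted by A. Both touch R at `dualMap V y` with slope y. -/
lemma hasGrad_dualMap (hP : (interior (polytope V)).Nonempty) (y : Euc n) :
    HasGrad (polyLegendre V) y (dualMap V y) := by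
  have := nonempty_fin_of_interior hP
  obtain ⟨A, hA, h⟩ := exists_weights_near_dualMap hP y
  have hN : HasFDerivAt (fun z => negEntropy (softmax V y + A (z - dualMap V y)))
      (innerSL ℝ y) (dualMap V y) := by
    have h1 : ∀ i, HasFDerivAt (fun z => (softmax V y + A (z - dualMap V y)) i)
        ((ContinuousLinearMap.proj (R := ℝ) (φ := fun _ : Fin q => ℝ) i).comp A)
        (dualMap V y) := by
      intro i
      have := (((ContinuousLinearMap.proj (R := ℝ) (φ := fun _ : Fin q => ℝ) i).comp A).hasFDerivAt
        (x := dualMap V y)).add_const (softmax V y i - A (dualMap V y) i)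
      refine this.congr_of_eventuallyEq (Eventually.of_forall fun z => ?_)
      simp
      ring
    have h2 : ∀ i, HasFDerivAt (fun z => (softmax V y + A (z - dualMap V y)) i *
        Real.log ((softmax V y + A (z - dualMap V y)) i))
        ((Real.log (softmax V y i) + 1) •
          ((ContinuousLinearMap.proj (R := ℝ) (φ := fun _ : Fin q => ℝ) i).comp A))
        (dualMap V y) := by
      intro i
      refine HasDerivAt.comp_hasFDerivAt (h₂ := fun t => t * Real.log t) _ ?_ (h1 i)
      simpa using Real.hasDerivAt_mul_log (softmax_pos y i).ne'
    refine (HasFDerivAt.fun_sum fun i (_ : i ∈ Finset.univ) => h2 i).congr_fderiv ?_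
    ext d
    -- The terms constant in i drop out of the sum because A d has total weight zero.
    have h3 : ∀ i, (Real.log (softmax V y i) + 1) * A d i =
        A d i * inner ℝ y (V i) + (1 - logSumExp V y) * A d i := by
      intro i
      rw [log_softmax]
      ring
    simp only [sum_apply, smul_apply,
      ContinuousLinearMap.comp_apply, ContinuousLinearMap.proj_apply, smul_eq_mul, h3,
      Finset.sum_add_distrib, ← Finset.mul_sum, (hA d).2, ← inner_sum_smul, (hA d).1]
    simp
  have hval : negEntropy (softmax V y + A (dualMap V y - dualMap V y)) =
      realLegendre V (dualMap V y) := by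
    rw [sub_self, map_zero, add_zero, negEntropy_softmax, realLegendre_dualMap]
  rw [HasGrad, hasGradientAt_iff_hasFDerivAt]
  change HasFDerivAt (realLegendre V) (innerSL ℝ y) (dualMap V y)
  rw [hasFDerivAt_iff_isLittleO] at hN ⊢
  refine (Asymptotics.IsBigO.of_bound 1 ?_).trans_isLittleO hN
  filter_upwards [h] with z hz
  have hzP : z ∈ polytope V := mem_polytope_iff.2 ⟨_, hz⟩
  have hlow := inner_sub_le_realLegendre y hzP
  have hup := realLegendre_le (V := V) hz.1
  rw [hz.2] at hup
  have hpos : 0 ≤ realLegendre V z - realLegendre V (dualMap V y) -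
      innerSL ℝ y (z - dualMap V y) := by
    rw [realLegendre_dualMap, innerSL_apply_apply, inner_sub_right]
    linarith
  rw [hval, one_mul, Real.norm_of_nonneg hpos]
  exact le_trans (by linarith) (le_abs_self _)

/-- By convexity the slopes along the segment to z bound its right derivative at x. The segment
stays in the polytope, so x may be a boundary point and the junk value of `toReal` outside is
harmless. -/
lemma inner_le_sub_of_hasGrad {x y z : Euc n} (hx : x ∈ polytope V) (hz : z ∈ polytope V)
    (h : HasGrad (polyLegendre V) y x) :
    inner ℝ y (z - x) ≤ realLegendre V z - realLegendre V x := by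
  have h' : HasFDerivAt (realLegendre V) (innerSL ℝ y) x := hasGradientAt_iff_hasFDerivAt.1 h
  have hd : HasDerivWithinAt (fun t : ℝ => realLegendre V (x + t • (z - x)))
      (inner ℝ y (z - x)) (Set.Ioi 0) 0 := by
    have hl : HasDerivAt (fun t : ℝ => x + t • (z - x)) (z - x) 0 := by
      simpa using ((hasDerivAt_id (0 : ℝ)).smul_const (z - x)).const_add x
    have := HasFDerivAt.comp_hasDerivAt (x := (0 : ℝ)) (f := fun t : ℝ => x + t • (z - x))
      (l := realLegendre V) (l' := innerSL ℝ y) (by simpa using h') hl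
    exact this.hasDerivWithinAt
  rw [hasDerivWithinAt_iff_tendsto_slope' (by simp)] at hd
  refine le_of_tendsto hd ?_
  filter_upwards [Ioo_mem_nhdsGT (zero_lt_one' ℝ)] with t ht
  have hc := convexOn_realLegendre.2 hx hz (sub_nonneg.2 ht.2.le) ht.1.le (sub_add_cancel 1 t)
  have he : x + t • (z - x) = (1 - t) • x + t • z := by module
  rw [slope_def_field, zero_smul, add_zero, sub_zero, div_le_iff₀ ht.1, he]
  simp only [smul_eq_mul] at hc
  linarith

lemma hasGrad_iff (hP : (interior (polytope V)).Nonempty) {x y : Euc n} (hx : x ∈ polytope V) :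
    HasGrad (polyLegendre V) y x ↔ x = dualMap V y := by
  have := nonempty_fin_of_interior hP
  refine ⟨fun h => eq_dualMap_of_realLegendre_le hx ?_, fun h => h ▸ hasGrad_dualMap hP y⟩
  have h1 := inner_le_sub_of_hasGrad hx (dualMap_mem y) h
  rw [realLegendre_dualMap, inner_sub_right] at h1
  linarith

lemma grad_dualMap (hP : (interior (polytope V)).Nonempty) (y : Euc n) :
    grad (polyLegendre V) (dualMap V y) = y :=
  (hasGrad_dualMap hP y).gradient

/-! ### The log-sum-exp function -/

/-- This subgradient inequality replaces differentiation of the dual function under the integral. -/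
lemma logSumExp_sub_le [Nonempty (Fin q)] (y z : Euc n) :
    logSumExp V y - logSumExp V z ≤ inner ℝ (y - z) (dualMap V y) := by
  have h := inner_sub_le_realLegendre z (dualMap_mem (V := V) y)
  rw [realLegendre_dualMap] at h
  rw [inner_sub_left]
  linarith

lemma inner_le_logSumExp [Nonempty (Fin q)] (y : Euc n) {x : Euc n} (hx : x ∈ polytope V) :
    inner ℝ y x ≤ logSumExp V y := by
  linarith [inner_sub_le_realLegendre y hx, realLegendre_nonpos hx]

lemma continuous_logSumExp [Nonempty (Fin q)] : Continuous (logSumExp V) :=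
  Continuous.log (by fun_prop) fun y => (sum_exp_pos y).ne'

lemma continuous_dualMap [Nonempty (Fin q)] : Continuous (dualMap V) := by
  have h := continuous_logSumExp (V := V)
  unfold dualMap softmax
  fun_prop

end Polytope

section Integrals

variable {X : Type*} [MeasurableSpace X] {μ : Measure X} {n q r : ℕ}

/-! ### Integrals of extended-real-valued functions -/

lemma eintegral_congr_ae {f f' : X → EReal} (h : f =ᵐ[μ] f') :
    eintegral μ f = eintegral μ f' := by
  rw [eintegral, eintegral, lintegral_congr_ae (h.mono fun x hx => congrArg EReal.toENNReal hx),
    lintegral_congr_ae (h.mono fun x hx => congrArg (fun a : EReal => (-a).toENNReal) hx)]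

lemma eintegral_coe {f : X → ℝ} (hf : Integrable f μ) :
    eintegral μ (fun x => (f x : EReal)) = ((∫ x, f x ∂μ : ℝ) : EReal) := by
  have h : ∀ f : X → ℝ, Integrable f μ → ∫⁻ x, ENNReal.ofReal (f x) ∂μ ≠ ∞ := fun f hf =>
    (lintegral_ofReal_le_lintegral_enorm f).trans_lt hf.2 |>.ne
  rw [integral_eq_lintegral_pos_part_sub_lintegral_neg_part hf, EReal.coe_sub, eintegral,
    EReal.coe_ennreal_toReal (h f hf), EReal.coe_ennreal_toReal (h (fun x => -f x) hf.neg)]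
  simp only [← EReal.coe_neg, EReal.real_coe_toENNReal]

/-- The integrable minorant keeps the negative part finite, which rules out ⊤ - ⊤. -/
lemma eintegral_eq_top {f : X → EReal} {s : Set X} (hs : NullMeasurableSet s μ) (hμs : μ s ≠ 0)
    (hf : ∀ᵐ x ∂μ, x ∈ s → f x = ⊤) {u : X → ℝ} (hu : Integrable u μ)
    (hfu : ∀ᵐ x ∂μ, (u x : EReal) ≤ f x) : eintegral μ f = ⊤ := by
  have h1 : ∫⁻ x, (f x).toENNReal ∂μ = ⊤ := by
    rw [eq_top_iff]
    calc ⊤ = ∫⁻ x, s.indicator (fun _ => ⊤) x ∂μ := by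
          rw [lintegral_indicator_const₀ hs, ENNReal.top_mul hμs]
      _ ≤ _ := by
          refine lintegral_mono_ae (hf.mono fun x hfx => ?_)
          by_cases hx : x ∈ s
          · simp [hfx hx]
          · simp [hx]
  have h2 : ∫⁻ x, (-f x).toENNReal ∂μ ≠ ⊤ := by
    refine ne_top_of_le_ne_top hu.2.ne (lintegral_mono_ae ?_)
    filter_upwards [hfu] with x hx
    refine (EReal.toENNReal_le_toENNReal (EReal.neg_le_neg_iff.2 hx)).trans ?_
    rw [← EReal.coe_neg, EReal.real_coe_toENNReal, ← enorm_neg]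
    exact Real.ofReal_le_enorm _
  rw [eintegral, h1, EReal.coe_ennreal_top]
  lift ∫⁻ x, (-f x).toENNReal ∂μ to NNReal using h2 with a
  exact EReal.top_sub_coe _

/-! ### Essentially bounded fields -/

lemma memLp_top_exists_bound {E : Type*} [NormedAddCommGroup E] {f : X → E} (hf : MemLp f ∞ μ) :
    ∃ C, ∀ᵐ x ∂μ, ‖f x‖ ≤ C := by
  refine ⟨(eLpNormEssSup f μ).toReal, ?_⟩
  have h := hf.2
  rw [eLpNorm_exponent_top] at h
  filter_upwards [enorm_ae_le_eLpNormEssSup f μ] with x hx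
  rw [← toReal_enorm]
  exact ENNReal.toReal_mono h.ne hx

lemma memLp_top_continuous_comp {E : Type*} [NormedAddCommGroup E] {φ : Euc n → E}
    (hφ : Continuous φ) {f : X → Euc n} (hf : MemLp f ∞ μ) : MemLp (fun x => φ (f x)) ∞ μ := by
  obtain ⟨C, hC⟩ := memLp_top_exists_bound hf
  obtain ⟨B, hB⟩ := (isCompact_closedBall (0 : Euc n) C).exists_bound_of_continuousOn
    hφ.continuousOn
  refine memLp_top_of_bound (hφ.comp_aestronglyMeasurable hf.1) B ?_
  filter_upwards [hC] with x hx
  exact hB _ (by simpa using hx)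

lemma integrable_inner_of_memLp_top {f η : X → Euc n} (hf : MemLp f ∞ μ) (hη : Integrable η μ) :
    Integrable (fun x => (inner ℝ (f x) (η x) : ℝ)) μ := by
  obtain ⟨C, hC⟩ := memLp_top_exists_bound hf
  refine (hη.norm.const_mul C).mono' (hf.1.inner hη.1) ?_
  filter_upwards [hC] with x hx
  exact (norm_inner_le_norm _ _).trans (mul_le_mul_of_nonneg_right hx (norm_nonneg _))

lemma continuous_integral_comp_sub [IsFiniteMeasure μ] {φ : Euc n → ℝ} (hφ : Continuous φ)
    {f : X → Euc n} (hf : MemLp f ∞ μ) : Continuous fun w => ∫ x, φ (f x - w) ∂μ := by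
  obtain ⟨C, hC⟩ := memLp_top_exists_bound hf
  refine continuous_iff_continuousAt.2 fun w₀ => ?_
  obtain ⟨B, hB⟩ := (isCompact_closedBall (0 : Euc n) (C + (‖w₀‖ + 1))).exists_bound_of_continuousOn
    hφ.continuousOn
  refine continuousAt_of_dominated (bound := fun _ => B) ?_ ?_ (integrable_const B) ?_
  · exact Eventually.of_forall fun w =>
      hφ.comp_aestronglyMeasurable (hf.1.sub aestronglyMeasurable_const)
  · have hw : ∀ᶠ w in 𝓝 w₀, ‖w‖ < ‖w₀‖ + 1 :=
      continuous_norm.continuousAt.eventually (gt_mem_nhds (lt_add_one _))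
    filter_upwards [hw] with w hw
    filter_upwards [hC] with x hx
    refine hB _ ?_
    rw [mem_closedBall_zero_iff]
    exact (norm_sub_le _ _).trans (add_le_add hx hw.le)
  · exact Eventually.of_forall fun x => by fun_prop

/-! ### The global constraints -/

variable {W : Matrix (Fin r) (Fin n) ℝ} {b : Fin r → ℝ}

lemma continuous_toLp_transpose_mulVec :
    Continuous fun m : Fin r → ℝ => (WithLp.toLp 2 (Wᵀ *ᵥ m) : Euc n) :=
  (PiLp.continuous_toLp 2 _).comp (Continuous.matrix_mulVec continuous_const continuous_id)

lemma inner_transpose_mulVec (m : Fin r → ℝ) (x : Euc n) :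
    inner ℝ (WithLp.toLp 2 (Wᵀ *ᵥ m) : Euc n) x = ∑ i, m i * (W *ᵥ x.ofLp) i := by
  rw [EuclideanSpace.inner_eq_star_dotProduct, star_trivial, Matrix.mulVec_transpose,
    dotProduct_comm, ← Matrix.dotProduct_mulVec, dotProduct]

lemma integrable_mulVec {η : X → Euc n} (hη : Integrable η μ) (i : Fin r) :
    Integrable (fun x => (W *ᵥ (η x).ofLp) i) μ := by
  have h := hη.const_inner (𝕜 := ℝ) (WithLp.toLp 2 (Wᵀ *ᵥ Pi.single i 1) : Euc n)
  simpa only [inner_transpose_mulVec, Pi.single_apply, ite_mul, one_mul, zero_mul,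
    Finset.sum_ite_eq', Finset.mem_univ, if_true] using h

lemma integral_inner_transpose_mulVec (m : Fin r → ℝ) {η : X → Euc n} (hη : Integrable η μ) :
    ∫ x, (inner ℝ (WithLp.toLp 2 (Wᵀ *ᵥ m) : Euc n) (η x) : ℝ) ∂μ =
      ∑ i, m i * globalValue μ W η i := by
  simp_rw [inner_transpose_mulVec, globalValue]
  rw [integral_finsetSum _ fun i _ => (integrable_mulVec hη i).const_mul _]
  simp_rw [integral_const_mul]

lemma globalValue_congr_ae {η η' : X → Euc n} (h : η =ᵐ[μ] η') :
    globalValue μ W η = globalValue μ W η' := by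
  ext i
  exact integral_congr_ae (h.mono fun x hx => by simp only [hx])

lemma integrable_of_mem_polytope [IsFiniteMeasure μ] {V : Fin q → Euc n} {η : X → Euc n}
    (hm : AEStronglyMeasurable η μ) (hη : ∀ᵐ x ∂μ, η x ∈ polytope V) : Integrable η μ := by
  obtain ⟨C, hC⟩ := (isCompact_polytope (V := V)).isBounded.exists_norm_le
  exact (integrable_const C).mono' hm (hη.mono fun x hx => hC _ hx)

/-! ### Existence of a multiplier by minimizing the dual function -/

variable (V : Fin q → Euc n)

/-- The dual function `m ↦ ∫ R*(c - Wᵀ m) + m · b`. -/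
noncomputable def dualFunction (μ : Measure X) (W : Matrix (Fin r) (Fin n) ℝ) (b : Fin r → ℝ)
    (c : X → Euc n) (m : Fin r → ℝ) : ℝ :=
  ∫ x, logSumExp V (c x - WithLp.toLp 2 (Wᵀ *ᵥ m)) ∂μ + ∑ i, m i * b i

variable {V} [IsFiniteMeasure μ] {c : X → Euc n}

lemma memLp_sub_const (hc : MemLp c ∞ μ) (w : Euc n) : MemLp (fun x => c x - w) ∞ μ :=
  hc.sub (memLp_const w)

lemma integrable_logSumExp [Nonempty (Fin q)] (hc : MemLp c ∞ μ) (w : Euc n) :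
    Integrable (fun x => logSumExp V (c x - w)) μ :=
  (memLp_top_continuous_comp continuous_logSumExp (memLp_sub_const hc w)).integrable le_top

lemma integrable_dualMap [Nonempty (Fin q)] (hc : MemLp c ∞ μ) (w : Euc n) :
    Integrable (fun x => dualMap V (c x - w)) μ :=
  (memLp_top_continuous_comp continuous_dualMap (memLp_sub_const hc w)).integrable le_top

/-- Weak duality, weakened by R ≤ 0. For a strictly feasible η the lower bound is affine in m with
positive slopes, hence coercive on m ≥ 0. -/
lemma le_dualFunction [Nonempty (Fin q)] (hc : MemLp c ∞ μ) {η : X → Euc n}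
    (hm : AEStronglyMeasurable η μ) (hη : ∀ᵐ x ∂μ, η x ∈ polytope V) (m : Fin r → ℝ) :
    ∫ x, (inner ℝ (c x) (η x) : ℝ) ∂μ + ∑ i, m i * (b i - globalValue μ W η i) ≤
      dualFunction V μ W b c m := by
  have hi := integrable_of_mem_polytope hm hη
  have h1 : ∫ x, (inner ℝ (c x - WithLp.toLp 2 (Wᵀ *ᵥ m)) (η x) : ℝ) ∂μ ≤
      ∫ x, logSumExp V (c x - WithLp.toLp 2 (Wᵀ *ᵥ m)) ∂μ :=
    integral_mono_ae (integrable_inner_of_memLp_top (memLp_sub_const hc _) hi)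
      (integrable_logSumExp hc _) (hη.mono fun x hx => inner_le_logSumExp _ hx)
  simp_rw [inner_sub_left] at h1
  rw [integral_sub (integrable_inner_of_memLp_top hc hi) (hi.const_inner _),
    integral_inner_transpose_mulVec m hi] at h1
  simp_rw [dualFunction, mul_sub, Finset.sum_sub_distrib]
  linarith

lemma exists_isMinOn_dualFunction [Nonempty (Fin q)] (hc : MemLp c ∞ μ) {η : X → Euc n}
    (hm : AEStronglyMeasurable η μ) (hη : ∀ᵐ x ∂μ, η x ∈ polytope V)
    (hb : ∀ i, globalValue μ W η i < b i) :
    ∃ m, 0 ≤ m ∧ ∀ m', 0 ≤ m' → dualFunction V μ W b c m ≤ dualFunction V μ W b c m' := by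
  have hcont : Continuous (dualFunction V μ W b c) := by
    have h1 := (continuous_integral_comp_sub (continuous_logSumExp (V := V)) hc).comp
      (continuous_toLp_transpose_mulVec (W := W))
    exact h1.add (by fun_prop)
  set D := dualFunction V μ W b c 0 - ∫ x, (inner ℝ (c x) (η x) : ℝ) ∂μ
  have hle := fun m => le_dualFunction (W := W) (b := b) hc hm hη m
  have hD : 0 ≤ D := by
    have := hle 0
    simp only [Pi.zero_apply, zero_mul, Finset.sum_const_zero, add_zero] at this
    exact sub_nonneg.2 this
  -- The box contains every m' ≥ 0 whose dual value is at most the value at 0, so a minimizer over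
  -- it is global.
  have h0 : (0 : Fin r → ℝ) ≤ fun i => D / (b i - globalValue μ W η i) := fun i =>
    div_nonneg hD (sub_nonneg.2 (hb i).le)
  obtain ⟨m, hmem, hmin⟩ := isCompact_Icc.exists_isMinOn (Set.nonempty_Icc.2 h0) hcont.continuousOn
  refine ⟨m, hmem.1, fun m' hm' => ?_⟩
  by_contra! hlt
  refine (hmin ⟨hm', fun i => ?_⟩).not_gt hlt
  rw [le_div_iff₀ (sub_pos.2 (hb i))]
  have h1 : m' i * (b i - globalValue μ W η i) ≤ ∑ j, m' j * (b j - globalValue μ W η j) :=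
    Finset.single_le_sum (f := fun j => m' j * (b j - globalValue μ W η j))
      (fun j _ => mul_nonneg (hm' j) (sub_nonneg.2 (hb j).le)) (Finset.mem_univ i)
  have h2 : dualFunction V μ W b c m ≤ dualFunction V μ W b c 0 :=
    hmin (Set.left_mem_Icc.2 h0)
  have h3 := hle m'
  simp only [D]
  linarith

/-- The increment from m to m + t e is bounded by the subgradient at the shifted point; dividing by
t and letting t → 0⁺ needs only continuity of the integral. -/
lemma nonneg_of_isMinOn_dualFunction [Nonempty (Fin q)] (hc : MemLp c ∞ μ) {m e : Fin r → ℝ}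
    (hmin : ∀ m', 0 ≤ m' → dualFunction V μ W b c m ≤ dualFunction V μ W b c m')
    (he : ∀ᶠ t : ℝ in 𝓝[>] 0, 0 ≤ m + t • e) :
    0 ≤ ∑ i, e i *
      (b i - globalValue μ W (fun x => dualMap V (c x - WithLp.toLp 2 (Wᵀ *ᵥ m))) i) := by
  set w : (Fin r → ℝ) → Euc n := fun m => WithLp.toLp 2 (Wᵀ *ᵥ m) with hw
  have hwadd : ∀ t : ℝ, w (m + t • e) = w m + t • w e := by
    intro t
    simp [hw, Matrix.mulVec_add, Matrix.mulVec_smul]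
  have hlim : Tendsto (fun t : ℝ => ∑ i, e i * b i -
      ∫ x, (inner ℝ (w e) (dualMap V (c x - w (m + t • e))) : ℝ) ∂μ) (𝓝[>] 0)
      (𝓝 (∑ i, e i * b i - ∫ x, (inner ℝ (w e) (dualMap V (c x - w m)) : ℝ) ∂μ)) := by
    have h1 := continuous_integral_comp_sub (φ := fun y => (inner ℝ (w e) (dualMap V y) : ℝ))
      (continuous_const.inner continuous_dualMap) hc
    have h2 : Continuous fun t : ℝ => ∑ i, e i * b i -
        ∫ x, (inner ℝ (w e) (dualMap V (c x - (w m + t • w e))) : ℝ) ∂μ :=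
      continuous_const.sub (h1.comp (g := fun w => ∫ x, _ ∂μ) (by fun_prop))
    have h3 := h2.tendsto 0
    simp only [zero_smul, add_zero] at h3
    simp only [hwadd]
    exact h3.mono_left nhdsWithin_le_nhds
  have hnonneg := ge_of_tendsto hlim (b := 0) (by
    filter_upwards [he, self_mem_nhdsWithin] with t ht ht0
    have h1 := hmin _ ht
    have h2 : ∫ x, logSumExp V (c x - w (m + t • e)) ∂μ - ∫ x, logSumExp V (c x - w m) ∂μ ≤
        -t * ∫ x, (inner ℝ (w e) (dualMap V (c x - w (m + t • e))) : ℝ) ∂μ := by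
      rw [← integral_sub (integrable_logSumExp hc _) (integrable_logSumExp hc _),
        ← integral_const_mul]
      refine integral_mono
        ((integrable_logSumExp hc _).sub (integrable_logSumExp hc _))
        (((integrable_dualMap hc _).const_inner _).const_mul _) fun x => ?_
      refine (logSumExp_sub_le _ _).trans_eq ?_
      have : c x - w (m + t • e) - (c x - w m) = (-t) • w e := by
        rw [hwadd]
        module
      rw [this, real_inner_smul_left]
    have h3 : ∑ i, (m + t • e) i * b i = ∑ i, m i * b i + t * ∑ i, e i * b i := by
      simp [add_mul, Finset.sum_add_distrib, Finset.mul_sum, mul_assoc]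
    simp only [dualFunction, h3] at h1
    refine nonneg_of_mul_nonneg_right (a := t) ?_ ht0
    simp only [hw] at h2 ⊢
    linarith)
  rw [integral_inner_transpose_mulVec e (integrable_dualMap hc _), ← Finset.sum_sub_distrib]
    at hnonneg
  simpa only [mul_sub] using hnonneg

/-- A multiplier for the optimality system. -/
lemma exists_multiplier [Nonempty (Fin q)] (hc : MemLp c ∞ μ) {η : X → Euc n}
    (hm : AEStronglyMeasurable η μ) (hη : ∀ᵐ x ∂μ, η x ∈ polytope V)
    (hb : ∀ i, globalValue μ W η i < b i) :
    ∃ m : Fin r → ℝ, (∀ i, 0 ≤ m i) ∧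
      (∀ i, globalValue μ W (fun x => dualMap V (c x - WithLp.toLp 2 (Wᵀ *ᵥ m))) i ≤ b i) ∧
      ∀ i, m i *
        (globalValue μ W (fun x => dualMap V (c x - WithLp.toLp 2 (Wᵀ *ᵥ m))) i - b i) = 0 := by
  obtain ⟨m, hm0, hmin⟩ := exists_isMinOn_dualFunction hc hm hη hb
  have hle : ∀ i,
      globalValue μ W (fun x => dualMap V (c x - WithLp.toLp 2 (Wᵀ *ᵥ m))) i ≤ b i := by
    intro i
    have h := nonneg_of_isMinOn_dualFunction hc hmin (e := Pi.single i 1) (by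
      filter_upwards [self_mem_nhdsWithin] with t ht
      exact add_nonneg hm0 (smul_nonneg (le_of_lt ht) (Pi.single_nonneg.2 zero_le_one)))
    simpa [Pi.single_apply] using h
  refine ⟨m, hm0, hle, fun i => ?_⟩
  rcases (hm0 i).eq_or_lt with h0 | h0
  · rw [← h0, Pi.zero_apply, zero_mul]
  -- A positive multiplier can also be decreased, which forces the reverse inequality.
  have h := nonneg_of_isMinOn_dualFunction hc hmin (e := Pi.single i (-1)) (by
    filter_upwards [Ioo_mem_nhdsGT h0] with t ht j
    rcases eq_or_ne j i with rfl | hj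
    · simpa using ht.2.le
    · simpa [hj] using hm0 j)
  have h1 : b i - globalValue μ W (fun x => dualMap V (c x - WithLp.toLp 2 (Wᵀ *ᵥ m))) i ≤ 0 := by
    simpa [Pi.single_apply] using h
  rw [le_antisymm (hle i) (by linarith), sub_self, mul_zero]

end Integrals

section Objective

variable {X : Type*} {n q r : ℕ} {V : Fin q → Euc n} {W : Matrix (Fin r) (Fin n) ℝ}
  {b : Fin r → ℝ} {α : ℝ} {g v η η' : X → Euc n}

/-! ### The objective -/

variable (V α g v) in
/-- The integrand of the objective, for values in the polytope. -/
noncomputable def integrand (η : X → Euc n) (x : X) : ℝ :=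
  realLegendre V (η x) - inner ℝ (grad (polyLegendre V) (v x) - α • g x) (η x) +
    (inner ℝ (grad (polyLegendre V) (v x)) (v x) - realLegendre V (v x))

lemma integrand_eq {x : X} (hv : v x ∈ polytope V) (hη : η x ∈ polytope V) :
    ((α * inner ℝ (g x) (η x) : ℝ) : EReal) + bregman (polyLegendre V) (η x) (v x) =
      (integrand V α g v η x : ℝ) := by
  rw [bregman, polyLegendre_eq_coe hv, polyLegendre_eq_coe hη, ← EReal.coe_sub, ← EReal.coe_sub,
    ← EReal.coe_add, integrand]
  congr 1
  rw [inner_sub_left, inner_sub_right, real_inner_smul_left]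
  ring

lemma integrand_eq_top {x : X} (hv : v x ∈ polytope V) (hη : η x ∉ polytope V) :
    ((α * inner ℝ (g x) (η x) : ℝ) : EReal) + bregman (polyLegendre V) (η x) (v x) = ⊤ := by
  rw [bregman, polyLegendre_eq_coe hv, polyLegendre_eq_top hη, EReal.top_sub_coe,
    EReal.top_sub_coe, EReal.coe_add_top]

variable [MeasurableSpace X] {μ : Measure X}

lemma integrable_realLegendre [IsFiniteMeasure μ] (hm : AEStronglyMeasurable η μ)
    (hη : ∀ᵐ x ∂μ, η x ∈ polytope V) : Integrable (fun x => realLegendre V (η x)) μ := by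
  -- Without vertices the polytope is empty, so the measure is zero; otherwise R lies between -ln q
  -- and 0.
  rcases isEmpty_or_nonempty (Fin q) with hq | hq
  · have h0 : μ = 0 := by
      rw [← ae_eq_bot, ← Filter.eventually_false_iff_eq_bot]
      refine hη.mono fun x hx => ?_
      obtain ⟨l, hl, -⟩ := mem_polytope_iff.1 hx
      simpa using hl.2
    simp [h0]
  · refine (integrable_const (Real.log q)).mono'
      (measurable_realLegendre.comp_aemeasurable hm.aemeasurable).aestronglyMeasurable
      (hη.mono fun x hx => ?_)
    rw [Real.norm_eq_abs, abs_le]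
    exact ⟨neg_log_card_le_realLegendre hx,
      (realLegendre_nonpos hx).trans (Real.log_natCast_nonneg q)⟩

variable [IsFiniteMeasure μ] (hv : AEStronglyMeasurable v μ) (hvP : ∀ᵐ x ∂μ, v x ∈ polytope V)
  (hRv : MemLp (fun x => grad (polyLegendre V) (v x)) ∞ μ) (hg : MemLp g ∞ μ)

include hv hvP hRv hg

lemma integrable_integrand (hη : Integrable η μ) (hηP : ∀ᵐ x ∂μ, η x ∈ polytope V) :
    Integrable (integrand V α g v η) μ :=
  ((integrable_realLegendre hη.1 hηP).sub
    (integrable_inner_of_memLp_top (hRv.sub (hg.const_smul α)) hη)).add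
    ((integrable_inner_of_memLp_top hRv (integrable_of_mem_polytope hv hvP)).sub
      (integrable_realLegendre hv hvP))

lemma objective_eq (hη : Integrable η μ) (hηP : ∀ᵐ x ∂μ, η x ∈ polytope V) :
    objective μ (polyLegendre V) α g v η = ((∫ x, integrand V α g v η x ∂μ : ℝ) : EReal) := by
  rw [← eintegral_coe (integrable_integrand hv hvP hRv hg hη hηP), objective]
  refine eintegral_congr_ae ?_
  filter_upwards [hvP, hηP] with x h1 h2
  exact integrand_eq h1 h2

lemma objective_eq_top (hη : Integrable η μ) (hηP : ¬ ∀ᵐ x ∂μ, η x ∈ polytope V) :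
    objective μ (polyLegendre V) α g v η = ⊤ := by
  have hs : NullMeasurableSet {x | η x ∈ (polytope V)ᶜ} μ :=
    hη.1.aemeasurable.nullMeasurable isCompact_polytope.isClosed.measurableSet.compl
  -- The minorant is the integrand with R(η) replaced by its lower bound -ln q.
  have hu : Integrable (fun x => -Real.log q -
      inner ℝ (grad (polyLegendre V) (v x) - α • g x) (η x) +
      (inner ℝ (grad (polyLegendre V) (v x)) (v x) - realLegendre V (v x))) μ :=
    ((integrable_const _).sub
    (integrable_inner_of_memLp_top (hRv.sub (hg.const_smul α)) hη)).add
    ((integrable_inner_of_memLp_top hRv (integrable_of_mem_polytope hv hvP)).sub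
      (integrable_realLegendre hv hvP))
  refine eintegral_eq_top hs (fun h0 => hηP h0) (hvP.mono fun x hx h => integrand_eq_top hx h) hu ?_
  filter_upwards [hvP] with x hx
  by_cases h : η x ∈ polytope V
  · have : Nonempty (Fin q) :=
      Set.range_nonempty_iff_nonempty.1 (convexHull_nonempty_iff.1 ⟨_, hx⟩)
    rw [integrand_eq hx h, EReal.coe_le_coe_iff, integrand]
    linarith [neg_log_card_le_realLegendre h]
  · rw [integrand_eq_top hx h]
    exact le_top

/-! ### Sufficiency and solvability of the optimality system. -/

/-- A field that satisfies the optimality system is the only feasible field at which the objective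
is at most its own value. -/
lemma IsKKT.ae_eq_of_objective_le (hP : (interior (polytope V)).Nonempty) {m : Fin r → ℝ}
    (hη : Integrable η μ) (h : IsKKT μ (polytope V) (polyLegendre V) W b α g v η m)
    (hη' : Integrable η' μ) (hb : ∀ i, globalValue μ W η' i ≤ b i)
    (hle : objective μ (polyLegendre V) α g v η' ≤ objective μ (polyLegendre V) α g v η) :
    η' =ᵐ[μ] η := by
  have := nonempty_fin_of_interior hP
  obtain ⟨hηint, hηb, hm, hcs, hgrad⟩ := h
  have hηP : ∀ᵐ x ∂μ, η x ∈ polytope V := hηint.mono fun x hx => interior_subset hx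
  rw [objective_eq hv hvP hRv hg hη hηP] at hle
  have hηP' : ∀ᵐ x ∂μ, η' x ∈ polytope V := by
    by_contra hcon
    rw [objective_eq_top hv hvP hRv hg hη' hcon] at hle
    exact EReal.coe_ne_top _ (top_le_iff.1 hle)
  rw [objective_eq hv hvP hRv hg hη' hηP', EReal.coe_le_coe_iff] at hle
  set w : Euc n := WithLp.toLp 2 (Wᵀ *ᵥ m) with hw
  set y : X → Euc n := fun x => grad (polyLegendre V) (v x) - α • g x - w with hy
  have hηy : ∀ᵐ x ∂μ, η x = dualMap V (y x) := by
    filter_upwards [hηP, hgrad] with x hx hgx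
    exact (hasGrad_iff hP hx).1 hgx
  have hI := integrable_integrand (α := α) hv hvP hRv hg hη hηP
  have hI' := integrable_integrand (α := α) hv hvP hRv hg hη' hηP'
  -- The Lagrangian difference: adding the multiplier term turns it into the Fenchel–Young gap of η'
  -- at y.
  set D : X → ℝ := fun x => integrand V α g v η' x - integrand V α g v η x +
    (inner ℝ w (η' x) - inner ℝ w (η x)) with hD
  have hDI : Integrable D μ := (hI'.sub hI).add ((hη'.const_inner w).sub (hη.const_inner w))
  have hDeq : ∀ᵐ x ∂μ,
      D x = realLegendre V (η' x) - (inner ℝ (y x) (η' x) - logSumExp V (y x)) := by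
    filter_upwards [hηy] with x hx
    have h1 := realLegendre_dualMap (V := V) (y x)
    rw [← hx] at h1
    simp only [hD, integrand, h1]
    simp only [hy, inner_sub_left]
    ring
  have hD0 : 0 ≤ᵐ[μ] D := by
    filter_upwards [hDeq, hηP'] with x hx hxP
    rw [hx]
    exact sub_nonneg.2 (inner_sub_le_realLegendre _ hxP)
  have hDint : ∫ x, D x ∂μ ≤ 0 := by
    have hsum : ∫ x, D x ∂μ = ∫ x, integrand V α g v η' x ∂μ - ∫ x, integrand V α g v η x ∂μ +
        (∫ x, (inner ℝ w (η' x) : ℝ) ∂μ - ∫ x, (inner ℝ w (η x) : ℝ) ∂μ) := by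
      rw [← integral_sub hI' hI, ← integral_sub (hη'.const_inner w) (hη.const_inner w)]
      exact integral_add (hI'.sub hI) ((hη'.const_inner w).sub (hη.const_inner w))
    rw [hsum, hw, integral_inner_transpose_mulVec m hη', integral_inner_transpose_mulVec m hη,
      ← Finset.sum_sub_distrib]
    -- Complementary slackness replaces m times the value at η by m · b, which dominates the term of
    -- the feasible η'.
    have : ∑ i, (m i * globalValue μ W η' i - m i * globalValue μ W η i) ≤ 0 := by
      refine Finset.sum_nonpos fun i _ => ?_
      have h1 := hcs i
      have h2 := mul_nonneg (hm i) (sub_nonneg.2 (hb i))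
      linarith
    linarith
  have hDz := (integral_eq_zero_iff_of_nonneg_ae hD0 hDI).1
    (le_antisymm hDint (integral_nonneg_of_ae hD0))
  filter_upwards [hDz, hDeq, hηP', hηy] with x h1 h2 h3 h4
  rw [h4]
  refine eq_dualMap_of_realLegendre_le h3 ?_
  rw [h2, Pi.zero_apply] at h1
  linarith

omit hv hvP in
/-- The optimality system has a solution, in terms of the gradient of the log-sum-exp function. -/
lemma exists_isKKT_dualMap (hP : (interior (polytope V)).Nonempty)
    (hη : AEStronglyMeasurable η μ) (hηP : ∀ᵐ x ∂μ, η x ∈ polytope V)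
    (hb : ∀ i, globalValue μ W η i < b i) :
    ∃ (m : Fin r → ℝ) (y : X → Euc n), MemLp y ∞ μ ∧
      IsKKT μ (polytope V) (polyLegendre V) W b α g v (fun x => dualMap V (y x)) m := by
  have := nonempty_fin_of_interior hP
  have hc : MemLp (fun x => grad (polyLegendre V) (v x) - α • g x) ∞ μ :=
    hRv.sub (hg.const_smul α)
  obtain ⟨m, hm, hmb, hcs⟩ := exists_multiplier hc hη hηP hb
  exact ⟨m, _, memLp_sub_const hc _, Eventually.of_forall fun x => dualMap_mem_interior hP _, hmb,
    hm, hcs, Eventually.of_forall fun x => hasGrad_dualMap hP _⟩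

omit [IsFiniteMeasure μ] hv hvP hRv hg in
lemma IsKKT.congr_ae {m : Fin r → ℝ} (h : IsKKT μ (polytope V) (polyLegendre V) W b α g v η m)
    (he : η =ᵐ[μ] η') : IsKKT μ (polytope V) (polyLegendre V) W b α g v η' m := by
  obtain ⟨h1, h2, h3, h4, h5⟩ := h
  rw [IsKKT, ← globalValue_congr_ae he]
  refine ⟨?_, h2, h3, h4, ?_⟩
  · filter_upwards [h1, he] with x hx hxe
    rwa [← hxe]
  · filter_upwards [h5, he] with x hx hxe
    rwa [← hxe]

/-- A field in `L^p` that satisfies the optimality system is the unique minimizer in `L^p`. -/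
lemma IsKKT.isUniqueMinimizer {p : ℝ≥0∞} (hp : 1 ≤ p) (hP : (interior (polytope V)).Nonempty)
    {m : Fin r → ℝ} {η : Lp (Euc n) p μ}
    (h : IsKKT μ (polytope V) (polyLegendre V) W b α g v η m) :
    IsUniqueMinimizer (fun η : Lp (Euc n) p μ => objective μ (polyLegendre V) α g v η)
      (globalSet p μ W b) η := by
  have key : ∀ η' ∈ globalSet p μ W b, objective μ (polyLegendre V) α g v η' ≤
      objective μ (polyLegendre V) α g v η → η' = η := fun η' hη' hle =>
    Lp.ext (h.ae_eq_of_objective_le hv hvP hRv hg hP ((Lp.memLp η).integrable hp)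
      ((Lp.memLp η').integrable hp) hη' hle)
  have hmem : η ∈ globalSet p μ W b := h.2.1
  refine ⟨hmem, fun η' hη' => ?_, fun η' hη' hmin => key η' hη' (hmin hmem)⟩
  change objective μ (polyLegendre V) α g v η ≤ objective μ (polyLegendre V) α g v η'
  by_contra! hlt
  have := key η' hη' hlt.le
  rw [this] at hlt
  exact lt_irrefl _ hlt

omit [IsFiniteMeasure μ] hv hvP hRv hg in
/-- The image under `dualMap` of a bounded field stays away from the boundary of the polytope. -/
lemma essInf_infEDist_dualMap_pos (hP : (interior (polytope V)).Nonempty) {y : X → Euc n}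
    (hy : MemLp y ∞ μ) (h : ∀ᵐ x ∂μ, η x = dualMap V (y x)) :
    0 < essInf (fun x => Metric.infEDist (η x) (frontier (polytope V))) μ := by
  have := nonempty_fin_of_interior hP
  obtain ⟨C, hC⟩ := memLp_top_exists_bound hy
  have hK : IsCompact (dualMap V '' Metric.closedBall 0 C) :=
    (isCompact_closedBall _ _).image continuous_dualMap
  -- A compact set disjoint from the closed frontier keeps a positive distance from it.
  have hdisj : Disjoint (dualMap V '' Metric.closedBall 0 C) (frontier (polytope V)) := by
    rw [Set.disjoint_left]
    rintro _ ⟨z, -, rfl⟩ hz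
    exact hz.2 (dualMap_mem_interior hP z)
  obtain ⟨δ, hδ, hlt⟩ := Metric.exists_pos_forall_lt_edist hK isClosed_frontier hdisj
  refine (ENNReal.coe_pos.2 hδ).trans_le (le_essInf_of_ae_le _ ?_)
  filter_upwards [h, hC] with x hx hxC
  refine Metric.le_infEDist.2 fun z hz => (hlt _ ?_ z hz).le
  rw [hx]
  exact Set.mem_image_of_mem _ (mem_closedBall_zero_iff.2 hxC)

end Objective

end MirrorDescent

theorem mainTheorem3 {d n q r : ℕ} (hn : 1 ≤ n)
    -- the design domain
    (Ω : Set (EuclideanSpace ℝ (Fin d))) (hΩ : MeasurableSet Ω) (hΩfin : volume Ω < ∞)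
    -- the vertices of a convex polytope with non-empty interior
    (V : Fin q → MirrorDescent.Euc n) (hVinj : Function.Injective V)
    (hVext : ∀ i, V i ∈ (MirrorDescent.polytope V).extremePoints ℝ)
    (hP : (interior (MirrorDescent.polytope V)).Nonempty)
    -- the global constraints, with a strictly feasible field
    (W : Matrix (Fin r) (Fin n) ℝ) (b : Fin r → ℝ)
    (hSlater : ∃ η ∈ MirrorDescent.pointwiseSet (volume.restrict Ω) (MirrorDescent.polytope V),
      ∀ i, MirrorDescent.globalValue (volume.restrict Ω) W η i < b i)
    -- the objective functional
    (F : Lp (MirrorDescent.Euc n) ∞ (volume.restrict Ω) → ℝ)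
    (hF : MirrorDescent.ContDiffWithPrimalGradientOn F
      (MirrorDescent.pointwiseSet (volume.restrict Ω) (MirrorDescent.polytope V) ∩
        MirrorDescent.globalSet ∞ (volume.restrict Ω) W b))
    -- the previous iterate and the gradient `g = ∇F(v)` there
    (v : Lp (MirrorDescent.Euc n) ∞ (volume.restrict Ω))
    (hv : v ∈ MirrorDescent.pointwiseInterior (volume.restrict Ω) (MirrorDescent.polytope V))
    (hRv : MemLp (fun x => MirrorDescent.grad (MirrorDescent.polyLegendre V) (v x)) ∞
      (volume.restrict Ω))
    (g : Lp (MirrorDescent.Euc n) ∞ (volume.restrict Ω))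
    (hg : MirrorDescent.HasPrimalGradientAt F g v)
    (α : ℝ) (hα : 0 < α) :
    ∃ ηs : Lp (MirrorDescent.Euc n) 1 (volume.restrict Ω),
      -- the unique minimizer in `L^1`
      MirrorDescent.IsUniqueMinimizer
        (fun η : Lp (MirrorDescent.Euc n) 1 (volume.restrict Ω) =>
          MirrorDescent.objective (volume.restrict Ω) (MirrorDescent.polyLegendre V) α g v η)
        (MirrorDescent.globalSet 1 (volume.restrict Ω) W b) ηs ∧
      -- its characterization
      (∀ η : Lp (MirrorDescent.Euc n) 1 (volume.restrict Ω),
        η = ηs ↔ ∃ m : Fin r → ℝ,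
          MirrorDescent.IsKKT (volume.restrict Ω) (MirrorDescent.polytope V)
            (MirrorDescent.polyLegendre V) W b α g v η m) ∧
      -- it is bounded away from the boundary, and `∇R` of it is essentially bounded
      MemLp (fun x => MirrorDescent.grad (MirrorDescent.polyLegendre V) (ηs x)) ∞
        (volume.restrict Ω) ∧
      ∃ ηi : Lp (MirrorDescent.Euc n) ∞ (volume.restrict Ω),
        (∀ᵐ x ∂(volume.restrict Ω), ηi x = ηs x) ∧
        ηi ∈ MirrorDescent.pointwiseInterior (volume.restrict Ω) (MirrorDescent.polytope V) ∧
        -- the unique minimizer in `L^∞`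
        MirrorDescent.IsUniqueMinimizer
          (fun η : Lp (MirrorDescent.Euc n) ∞ (volume.restrict Ω) =>
            MirrorDescent.objective (volume.restrict Ω) (MirrorDescent.polyLegendre V) α g v η)
          (MirrorDescent.globalSet ∞ (volume.restrict Ω) W b) ηi := by
  have : IsFiniteMeasure (volume.restrict Ω) := isFiniteMeasure_restrict.2 hΩfin.ne
  obtain ⟨η₀, hη₀P, hη₀b⟩ := hSlater
  have hg' : MemLp g ∞ (volume.restrict Ω) := Lp.memLp g
  obtain ⟨m, y, hy, hKKT⟩ := MirrorDescent.exists_isKKT_dualMap (α := α) hRv hg' hP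
    (Lp.memLp η₀).1 hη₀P hη₀b
  have := MirrorDescent.nonempty_fin_of_interior hP
  have hη := MirrorDescent.memLp_top_continuous_comp
    (MirrorDescent.continuous_dualMap (V := V)) hy
  have hη1 := hη.mono_exponent (p := 1) le_top
  have hKKT1 := hKKT.congr_ae hη1.coeFn_toLp.symm
  have hKKTi := hKKT.congr_ae hη.coeFn_toLp.symm
  have hmin := hKKT1.isUniqueMinimizer (Lp.memLp v).1 hv.1 hRv hg' le_rfl hP
  refine ⟨hη1.toLp _, hmin, fun η => ⟨?_, ?_⟩, ?_, hη.toLp _, ?_, ⟨?_, ?_⟩, ?_⟩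
  · rintro rfl
    exact ⟨m, hKKT1⟩
  -- Any solution of the system, whatever its multiplier, is itself a minimizer, so uniqueness
  -- applies.
  · rintro ⟨m', hm'⟩
    exact hmin.2.2 η hm'.2.1
      (hm'.isUniqueMinimizer (Lp.memLp v).1 hv.1 hRv hg' le_rfl hP).2.1
  -- The gradient of R at the minimizer is the bounded dual field y.
  · refine hy.ae_eq ?_
    filter_upwards [hη1.coeFn_toLp] with x hx
    rw [hx, MirrorDescent.grad_dualMap hP]
  · exact hη.coeFn_toLp.trans hη1.coeFn_toLp.symm
  · exact hKKTi.1.mono fun x hx => interior_subset hx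
  · exact MirrorDescent.essInf_infEDist_dualMap_pos hP hy hη.coeFn_toLp
  · exact hKKTi.isUniqueMinimizer (Lp.memLp v).1 hv.1 hRv hg' le_top hP
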